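/- Graphs are finite undirected multigraphs $G=(V,E,\delta)$ without loops: every edge $e\in E$ has a set $\delta(e)$ of two distinct ends, and parallel edges are allowed. A set of edges is a spanning tree of $G$ if, together with all vertices of $G$, it forms a (nonempty) connected graph without cycles. A graph is bispanning if its edge set is the disjoint union of two spanning trees. A bispanning graph is atomic if its only bispanning subgraphs are itself and single vertices. For $X\subseteq V$, the contraction $G/X$ is obtained by deleting all edges with both ends in $X$ and merging the vertices of $X$ into one vertex; all other edges are kept. For an edge $f$ with ends $a,b$, a vertex $c$ of a graph $H$ and a new vertex $v$, the edge-split-attach operation of $f$ at $c$ turns $H$ into the graph obtained by deleting $f$ and adding $v$ together with three new edges $\{a,v\},\{b,v\},\{c,v\}$. **Theorem.** Let $G=(V,E,\delta)$ be an atomic bispanning graph and let $v\in V$ be a vertex of degree $3$ whose set of adjacent vertices is $\{x,y,z\}$. Then $x,y,z$ are pairwise distinct. Let $e_x,e_y,e_z$ be the edges joining $v$ to $x,y,z$. For $(a,b)\in\{(x,y),(x,z),(y,z)\}$ let $c$ be the remaining element of $\{x,y,z\}$ and put $$G_{a,b}:=G/\{v,a\}-e_c ,\qquad G'_{a,b}:=G/\{v,b\}-e_c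 ,$$ where the vertex resulting from the contraction is again called $a$ and $b$, respectively (so that $e_c$ has become an edge with ends $a,c$, respectively $b,c$). Then: 1. $G_{a,b}$ and $G'_{a,b}$ are bispanning. 2. Both are equal to $G-v+\{a,b\}$, the graph obtained from $G$ by deleting $v$ and adding one new edge $e_{a,b}$ with ends $a,b$; they differ only in the name of this edge, which is $e_b$ in $G_{a,b}$ and $e_a$ in $G'_{a,b}$. In particular, this edge remains after the contraction and has the ends $a$ and $b$. 3. $G$ arises from $G_{a,b}$ (and from $G'_{a,b}$) by the edge-split-attach operation of $e_{a,b}$ at $c$ with new vertex $v$ and new edges $e_a,e_b,e_c$. -/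

import Mathlib

/-!
Undirected multigraphs are Mathlib's `Graph α β` (vertices in `α`, named edges in `β`), where
`G.IsLink e u w` says that `e` is an edge with ends `u` and `w`, and `H ≤ G` says that `H` is a
subgraph of `G`. Mathlib's graphs may have loops; a bispanning graph has none, because a loop is
a cycle (of length one) and every edge lies in one of the two trees.
-/

open scoped Graph

namespace Graph

variable {α β : Type*}

/-- The sequence `u₀, e₀, u₁, …, eₙ₋₁, uₙ` is a walk in `G`. -/
def IsWalk (G : Graph α β) {n : ℕ} (u : Fin (n + 1) → α) (e : Fin n → β) : Prop :=
  u 0 ∈ V(G) ∧ ∀ i : Fin n, G.IsLink (e i) (u i.castSucc) (u i.succ)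

/-- A path is a walk that visits no vertex twice. -/
def IsPath (G : Graph α β) {n : ℕ} (u : Fin (n + 1) → α) (e : Fin n → β) : Prop :=
  G.IsWalk u e ∧ Function.Injective u

/-- A cycle is a closed walk of positive length that repeats neither an edge nor, apart from
`uₙ = u₀`, a vertex. Two parallel edges form a cycle of length two. -/
def IsCycle (G : Graph α β) {n : ℕ} (u : Fin (n + 1) → α) (e : Fin n → β) : Prop :=
  G.IsWalk u e ∧ 0 < n ∧ u (Fin.last n) = u 0 ∧
    Function.Injective (fun i : Fin n => u i.castSucc) ∧ Function.Injective e

/-- A connected (nonempty) graph: every two vertices are joined by a path. -/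
def IsConnected (G : Graph α β) : Prop :=
  V(G).Nonempty ∧ ∀ a ∈ V(G), ∀ b ∈ V(G),
    ∃ (n : ℕ) (u : Fin (n + 1) → α) (e : Fin n → β),
      G.IsPath u e ∧ u 0 = a ∧ u (Fin.last n) = b

/-- A forest: a graph without cycles. -/
def IsForest (G : Graph α β) : Prop :=
  ∀ (n : ℕ) (u : Fin (n + 1) → α) (e : Fin n → β), ¬ G.IsCycle u e

/-- A set `T` of edges of `G` is a spanning tree of `G` if the graph with all vertices of `G` and
with edge set `T` is a connected forest. -/
def IsSpanningTree (G : Graph α β) (T : Set β) : Prop :=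
  T ⊆ E(G) ∧ (G.restrict T).IsConnected ∧ (G.restrict T).IsForest

/-- `G` is bispanning if its edge set is the disjoint union of two spanning trees. -/
def IsBispanning (G : Graph α β) : Prop :=
  ∃ S T : Set β, G.IsSpanningTree S ∧ G.IsSpanningTree T ∧ S ∪ T = E(G) ∧ S ∩ T = ∅

/-- `G` is atomic bispanning if it is bispanning and its only bispanning subgraphs are `G` itself
and single vertices. -/
def IsAtomicBispanning (G : Graph α β) : Prop :=
  G.IsBispanning ∧
    ∀ H : Graph α β, H ≤ G → H.IsBispanning → H = G ∨ ∃ u : α, H = Graph.noEdge {u} β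

/-- The degree of `v`: the number of edges incident to `v` (for graphs without loops). -/
noncomputable def degree (G : Graph α β) (v : α) : ℕ := (G.incidenceSet v).ncard

open Classical in
/-- The contraction `G / X`: the edges with both ends in `X` are removed, and the vertices in `X`
are merged into one vertex, which gets the name `p` (a new vertex, or a member of `X`); every
other edge keeps its name. -/
noncomputable def contract (G : Graph α β) (X : Set α) (p : α) : Graph α β :=
  (G.deleteEdges {e | ∃ a ∈ X, ∃ b ∈ X, G.IsLink e a b}).map (fun u => if u ∈ X then p else u)

/-- `G + {a, b}`, where the added edge is named `f` (meant for `f ∉ E(G)`). The ends `a` and `b`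
are added as vertices if necessary. -/
def addEdge (G : Graph α β) (f : β) (a b : α) : Graph α β where
  vertexSet := V(G) ∪ {a, b}
  edgeSet := E(G) ∪ {f}
  IsLink e u w := (e ≠ f ∧ G.IsLink e u w) ∨ (e = f ∧ ((u = a ∧ w = b) ∨ (u = b ∧ w = a)))
  isLink_symm e _ := ⟨fun u w h => by
    rcases h with ⟨h, h'⟩ | ⟨h, h'⟩
    · exact Or.inl ⟨h, h'.symm⟩
    · exact Or.inr ⟨h, by tauto⟩⟩
  eq_or_eq_of_isLink_of_isLink := by
    rintro e x y v w (⟨h, h'⟩ | ⟨h, h'⟩) (⟨k, k'⟩ | ⟨k, k'⟩)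
    · exact h'.left_eq_or_eq k'
    · exact absurd k h
    · exact absurd h k
    · rcases h' with ⟨rfl, rfl⟩ | ⟨rfl, rfl⟩ <;> rcases k' with ⟨rfl, rfl⟩ | ⟨rfl, rfl⟩ <;> simp
  edge_mem_iff_exists_isLink e := by
    constructor
    · intro h
      by_cases hf : e = f
      · exact ⟨a, b, Or.inr ⟨hf, Or.inl ⟨rfl, rfl⟩⟩⟩
      · rcases h with h | h
        · obtain ⟨x, y, hxy⟩ := G.exists_isLink_of_mem_edgeSet h
          exact ⟨x, y, Or.inl ⟨hf, hxy⟩⟩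
        · exact absurd h hf
    · rintro ⟨x, y, ⟨_, h⟩ | ⟨h, _⟩⟩
      · exact Or.inl h.edge_mem
      · exact Or.inr h
  left_mem_of_isLink := by
    rintro e x y (⟨_, h⟩ | ⟨_, ⟨h, _⟩ | ⟨h, _⟩⟩)
    · exact Or.inl h.left_mem
    · exact Or.inr (Or.inl h)
    · exact Or.inr (Or.inr h)

/-- `G` arises from `H` by an edge-split-attach operation: the edge `f` of `H`, with ends `a` and
`b`, is split by the new vertex `v` into the new edges `ea = {a, v}` and `eb = {b, v}`, and `v` is
attached to the vertex `c` of `H` by the new edge `ec = {c, v}`. (The name `f` may be used again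
for one of the new edges.) -/
def IsEdgeSplitAttach (H G : Graph α β) (f : β) (a b c v : α) (ea eb ec : β) : Prop :=
  H.IsLink f a b ∧ c ∈ V(H) ∧ v ∉ V(H) ∧
  ea ∉ E(H) \ {f} ∧ eb ∉ E(H) \ {f} ∧ ec ∉ E(H) \ {f} ∧ ea ≠ eb ∧ ea ≠ ec ∧ eb ≠ ec ∧
  G = (((H.deleteEdges {f}).addEdge ea a v).addEdge eb b v).addEdge ec c v

end Graph

/-! Both reduction graphs are `G - v` with one more edge `f = {a, b}`. Two disjoint spanning trees
of `G` share the three edges at `v` as one and two. Without `v`, the first is a spanning tree `A₀`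
of `G - v` and the second a forest `B₀` with at most two components. As the pair `a`, `b` is
arbitrary, `f` need not connect these components.

As in matroid union, the edge left over is therefore exchanged repeatedly for an edge of its
fundamental cycle in one of the two sets. If some edge left over connects the two components of the
second set, the graph is bispanning. Otherwise let `F` be the set of all edges that can be left
over. The cycles used in the exchanges lie in `F`, so `A₀ ∩ F` and `B₀ ∩ F` join the same vertices,
among them `a` and `b` (`joined_inter_exchangeSet`, `IsPartition.isBispanning_or_exists`). Their
component containing `a` and `b` carries a bispanning subgraph of `G` that avoids `v`
(`exists_isBispanning_subgraph`), against atomicity.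

Atomicity also makes the neighbours distinct, since two parallel edges form a bispanning subgraph.
The statements on contraction and splitting are direct comparisons of links. -/

namespace Graph

variable {α β : Type*}

/-! ### Joined vertices and acyclic edge sets -/

/-- Two vertices are joined by `X` if some walk of `G` with edges in `X` leads from one to the
other. -/
def Joined (G : Graph α β) (X : Set β) : α → α → Prop :=
  Relation.ReflTransGen fun p q => ∃ e ∈ X, G.IsLink e p q

/-- A set of edges is acyclic if each of its edges is a bridge. -/
def EdgeAcyclic (G : Graph α β) (X : Set β) : Prop :=
  ∀ e ∈ X, ∀ p q, G.IsLink e p q → ¬ G.Joined (X \ {e}) p q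

namespace Joined

variable {G H : Graph α β} {X Y : Set β} {p q r s t : α} {e g : β}

lemma refl : G.Joined X p p := Relation.ReflTransGen.refl

lemma trans (h : G.Joined X p q) (h' : G.Joined X q r) : G.Joined X p r :=
  Relation.ReflTransGen.trans h h'

lemma symm (h : G.Joined X p q) : G.Joined X q p := by
  induction h with
  | refl => exact refl
  | tail _ h ih =>
    obtain ⟨e, he, hl⟩ := h
    exact Relation.ReflTransGen.head ⟨e, he, hl.symm⟩ ih

lemma single (he : e ∈ X) (h : G.IsLink e p q) : G.Joined X p q :=
  Relation.ReflTransGen.single ⟨e, he, h⟩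

/-- A walk may be replaced edge by edge. -/
lemma lift (h : G.Joined X p q)
    (hXY : ∀ e ∈ X, ∀ a b, G.IsLink e a b → H.Joined Y a b) : H.Joined Y p q := by
  induction h with
  | refl => exact refl
  | tail _ h ih =>
    obtain ⟨e, he, hl⟩ := h
    exact ih.trans (hXY e he _ _ hl)

lemma mono (hXY : X ⊆ Y) (h : G.Joined X p q) : G.Joined Y p q :=
  h.lift fun _ he _ _ hl => single (hXY he) hl

lemma mem (h : G.Joined X p q) (hp : p ∈ V(G)) : q ∈ V(G) := by
  induction h with
  | refl => exact hp
  | tail _ h _ => exact h.choose_spec.2.right_mem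

/-- Whatever a walk does between its first and last crossing of `g` can be cut out, so at most one
crossing, in one of the two directions, remains. -/
lemma of_insert (hg : G.IsLink g s t) (h : G.Joined (insert g X) p q) :
    G.Joined X p q ∨ (G.Joined X p s ∧ G.Joined X t q) ∨ (G.Joined X p t ∧ G.Joined X s q) := by
  induction h with
  | refl => exact Or.inl refl
  | tail _ h ih =>
    obtain ⟨e, rfl | he, hl⟩ := h
    · obtain ⟨rfl, rfl⟩ | ⟨rfl, rfl⟩ := hl.eq_and_eq_or_eq_and_eq hg
      · rcases ih with ih | ih | ih
        · exact Or.inr (Or.inl ⟨ih, refl⟩)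
        · exact Or.inr (Or.inl ⟨ih.1, refl⟩)
        · exact Or.inl ih.1
      · rcases ih with ih | ih | ih
        · exact Or.inr (Or.inr ⟨ih, refl⟩)
        · exact Or.inl ih.1
        · exact Or.inr (Or.inr ⟨ih.1, refl⟩)
    · have := single he hl
      rcases ih with ih | ih | ih
      · exact Or.inl (ih.trans this)
      · exact Or.inr (Or.inl ⟨ih.1, ih.2.trans this⟩)
      · exact Or.inr (Or.inr ⟨ih.1, ih.2.trans this⟩)

/-- Deleting an edge needed to join `p` to `q` leaves each of its ends joined to one of them. -/
lemma of_sdiff (hg : G.IsLink g s t) (h : G.Joined X p q) (hn : ¬ G.Joined (X \ {g}) p q) :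
    (G.Joined (X \ {g}) p s ∧ G.Joined (X \ {g}) t q) ∨
      (G.Joined (X \ {g}) p t ∧ G.Joined (X \ {g}) s q) := by
  have h' : G.Joined (insert g (X \ {g})) p q := h.mono (by
    intro e he; by_cases h : e = g <;> simp [h, he])
  exact (h'.of_insert hg).resolve_left hn

/-- Exchanging an edge needed to join `p` to `q` for an edge with ends `p` and `q` does not change
which vertices are joined. -/
lemma exchange_iff (he : G.IsLink e p q) (hg : G.IsLink g s t) (hgX : g ∈ X)
    (h : G.Joined X p q) (hn : ¬ G.Joined (X \ {g}) p q) {a b : α} :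
    G.Joined (insert e (X \ {g})) a b ↔ G.Joined X a b := by
  constructor
  · intro hab
    refine hab.lift ?_
    rintro f (rfl | hf) c d hl
    · obtain ⟨rfl, rfl⟩ | ⟨rfl, rfl⟩ := hl.eq_and_eq_or_eq_and_eq he
      · exact h
      · exact h.symm
    · exact single hf.1 hl
  · intro hab
    refine hab.lift fun f hf c d hl => ?_
    by_cases hfg : f = g
    · subst hfg
      have hpq : G.Joined (insert e (X \ {f})) p q := single (Set.mem_insert _ _) he
      -- The edge `g` is replaced by the rest of the cycle: from one end back to `p` or `q`, across
      -- `e`, and on to the other end.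
      have key : G.Joined (insert e (X \ {f})) s t := by
        have hs := Set.subset_insert e (X \ {f})
        rcases h.of_sdiff hg hn with ⟨h1, h2⟩ | ⟨h1, h2⟩
        · exact ((h1.mono hs).symm.trans hpq).trans (h2.mono hs).symm
        · exact ((h2.mono hs).trans hpq.symm).trans (h1.mono hs)
      obtain ⟨rfl, rfl⟩ | ⟨rfl, rfl⟩ := hl.eq_and_eq_or_eq_and_eq hg
      · exact key
      · exact key.symm
    · exact single (Set.mem_insert_of_mem _ ⟨hf, hfg⟩) hl

end Joined

section

variable {G H : Graph α β} {X Y : Set β} {p q s t : α} {e g : β}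

lemma EdgeAcyclic.mono (h : G.EdgeAcyclic X) (hYX : Y ⊆ X) : G.EdgeAcyclic Y :=
  fun e he p q hl hj => h e (hYX he) p q hl (hj.mono (Set.sdiff_subset_sdiff_left hYX))

lemma EdgeAcyclic.congr (h : G.EdgeAcyclic X)
    (hGH : ∀ e ∈ X, ∀ p q, H.IsLink e p q → G.IsLink e p q) : H.EdgeAcyclic X :=
  fun e he p q hl hj => h e he p q (hGH e he p q hl)
    (hj.lift fun f hf _ _ hl => .single hf (hGH f hf.1 _ _ hl))

/-- A new cycle would have to pass through `e`, and its other edges would then join `p` to `q`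
within `X`. -/
lemma EdgeAcyclic.insert (h : G.EdgeAcyclic X) (he : G.IsLink e p q) (hn : ¬ G.Joined X p q) :
    G.EdgeAcyclic (insert e X) := by
  intro f hf c d hl hj
  by_cases hfe : f = e
  · subst hfe
    have hj' := hj.mono (Y := X) (by rintro x ⟨rfl | hx, hx'⟩; exacts [absurd rfl hx', hx])
    obtain ⟨rfl, rfl⟩ | ⟨rfl, rfl⟩ := hl.eq_and_eq_or_eq_and_eq he
    exacts [hn hj', hn hj'.symm]
  · have hfX : f ∈ X := hf.resolve_left hfe
    have hs : X \ {f} ⊆ X := Set.sdiff_subset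
    have hj' := hj.mono (Y := Insert.insert e (X \ {f})) (by
      rintro x ⟨rfl | hx, hx'⟩; exacts [Or.inl rfl, Or.inr ⟨hx, hx'⟩])
    have hcd : G.Joined X c d := .single hfX hl
    rcases hj'.of_insert he with h1 | ⟨h1, h2⟩ | ⟨h1, h2⟩
    · exact h f hfX c d hl h1
    · exact hn (((h1.mono hs).symm.trans hcd).trans (h2.mono hs).symm)
    · exact hn (((h2.mono hs).trans hcd.symm).trans (h1.mono hs))

/-- In a finite acyclic set of edges, two joined vertices are joined by the edges that are needed
to join them. -/
lemma EdgeAcyclic.joined_needed (hX : X.Finite) (h : G.EdgeAcyclic X) (hE : X ⊆ E(G))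
    (hpq : G.Joined X p q) : G.Joined {g ∈ X | ¬ G.Joined (X \ {g}) p q} p q := by
  -- An inclusion-minimal joining set `C` plays the path from `p` to `q`. If `X` joined `p` to `q`
  -- without some `g ∈ C`, then this connection and the rest of `C` would join the ends of `g`
  -- without `g`.
  have hfin : {C | C ⊆ X ∧ G.Joined C p q}.Finite :=
    hX.finite_subsets.subset fun C hC => hC.1
  obtain ⟨C, ⟨hCX, hC⟩, hmin⟩ := hfin.exists_minimal ⟨X, subset_rfl, hpq⟩
  refine hC.mono fun g hg => ⟨hCX hg, fun hj => ?_⟩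
  obtain ⟨s, t, hst⟩ := G.exists_isLink_of_mem_edgeSet (hE (hCX hg))
  have hn : ¬ G.Joined (C \ {g}) p q := fun hc =>
    (hmin ⟨Set.sdiff_subset.trans hCX, hc⟩ Set.sdiff_subset hg).2 rfl
  have hs : C \ {g} ⊆ X \ {g} := Set.sdiff_subset_sdiff_left hCX
  refine h g (hCX hg) s t hst ?_
  rcases hC.of_sdiff hst hn with ⟨h1, h2⟩ | ⟨h1, h2⟩
  · exact ((h1.mono hs).symm.trans hj).trans (h2.mono hs).symm
  · exact ((h2.mono hs).trans hj.symm).trans (h1.mono hs)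

/-! ### Paths, cycles and spanning trees in terms of joined vertices -/

lemma IsWalk.joined {n : ℕ} {u : Fin (n + 1) → α} {w : Fin n → β}
    (h : (G.restrict X).IsWalk u w) (i : Fin (n + 1)) : G.Joined X (u 0) (u i) := by
  induction i using Fin.induction with
  | zero => exact .refl
  | succ i ih => exact ih.trans (.single (h.2 i).1 (h.2 i).2)

/-- An edge used again in the opposite direction would need `i = j + 1` and `j = i + 1` at once. -/
lemma IsPath.edge_injective {n : ℕ} {u : Fin (n + 1) → α} {w : Fin n → β} (h : G.IsPath u w) :
    Function.Injective w := by
  intro i j hij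
  have hi := h.1.2 i
  rw [hij] at hi
  rcases hi.eq_and_eq_or_eq_and_eq (h.1.2 j) with ⟨h1, _⟩ | ⟨h1, h2⟩
  · exact Fin.castSucc_injective _ (h.2 h1)
  · have h1 := congrArg Fin.val (h.2 h1)
    have h2 := congrArg Fin.val (h.2 h2)
    simp at h1 h2
    omega

lemma Joined.exists_isPath (hp : p ∈ V(G)) (h : G.Joined X p q) :
    ∃ (n : ℕ) (u : Fin (n + 1) → α) (w : Fin n → β),
      (G.restrict X).IsPath u w ∧ u 0 = p ∧ u (Fin.last n) = q := by
  induction h with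
  | refl =>
    refine ⟨0, fun _ => p, Fin.elim0, ⟨⟨hp, fun i => i.elim0⟩, ?_⟩, rfl, rfl⟩
    intro i j _
    exact Subsingleton.elim (α := Fin 1) i j
  | @tail b c _ h ih =>
    obtain ⟨e, he, hl⟩ := h
    obtain ⟨n, u, w, ⟨hw, hu⟩, h0, hlast⟩ := ih
    -- If the next vertex was visited before, the path is cut off there; otherwise it is extended.
    by_cases hc : ∃ i, u i = c
    · obtain ⟨i, hi⟩ := hc
      have hin : i.val + 1 ≤ n + 1 := i.isLt
      refine ⟨i, fun j => u (Fin.castLE hin j), fun j => w (Fin.castLE (by omega) j),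
        ⟨⟨hw.1, fun j => hw.2 (Fin.castLE (by omega) j)⟩,
          hu.comp (Fin.castLE_injective hin)⟩, h0, hi⟩
    · push Not at hc
      refine ⟨n + 1, Fin.snoc u c, Fin.snoc w e, ⟨⟨?_, ?_⟩, ?_⟩, ?_, by simp⟩
      · rw [← Fin.castSucc_zero, Fin.snoc_castSucc]
        exact hw.1
      · intro i
        induction i using Fin.lastCases with
        | last =>
          rw [Fin.snoc_last, Fin.snoc_castSucc, Fin.succ_last, Fin.snoc_last, hlast]
          exact ⟨he, hl⟩
        | cast i =>
          rw [Fin.snoc_castSucc, Fin.snoc_castSucc, Fin.succ_castSucc, Fin.snoc_castSucc]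
          exact hw.2 i
      · intro i j hij
        induction i using Fin.lastCases with
        | last =>
          induction j using Fin.lastCases with
          | last => rfl
          | cast j => exact absurd (by simpa using hij.symm) (hc j)
        | cast i =>
          induction j using Fin.lastCases with
          | last => exact absurd (by simpa using hij) (hc i)
          | cast j => exact congrArg Fin.castSucc (hu (by simpa using hij))
      · rw [← Fin.castSucc_zero, Fin.snoc_castSucc, h0]

lemma isConnected_restrict_iff :
    (G.restrict X).IsConnected ↔
      V(G).Nonempty ∧ ∀ a ∈ V(G), ∀ b ∈ V(G), G.Joined X a b := by
  refine and_congr Iff.rfl ⟨fun h a ha b hb => ?_, fun h a ha b hb => ?_⟩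
  · obtain ⟨n, u, w, hP, rfl, rfl⟩ := h a ha b hb
    exact hP.1.joined _
  · exact (h a ha b hb).exists_isPath ha

/-- An edge closes a path that joins its ends without it to a cycle (a loop closes the path of
length zero). Conversely, the other edges of a cycle join the ends of its first edge. -/
lemma isForest_restrict_iff : (G.restrict X).IsForest ↔ G.EdgeAcyclic X := by
  constructor
  · intro h e he p q hl hj
    obtain ⟨n, u, w, hP, h0, hlast⟩ := hj.exists_isPath hl.left_mem
    have hwX : ∀ i, w i ∈ X \ {e} := fun i => (hP.1.2 i).1
    refine h (n + 1) (Fin.snoc u p) (Fin.snoc w e) ⟨⟨?_, ?_⟩, n.succ_pos, ?_, ?_, ?_⟩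
    · rw [← Fin.castSucc_zero, Fin.snoc_castSucc]
      exact hP.1.1
    · intro i
      induction i using Fin.lastCases with
      | last =>
        rw [Fin.snoc_last, Fin.snoc_castSucc, Fin.succ_last, Fin.snoc_last, hlast]
        exact ⟨he, hl.symm⟩
      | cast i =>
        rw [Fin.snoc_castSucc, Fin.snoc_castSucc, Fin.succ_castSucc, Fin.snoc_castSucc]
        exact ⟨(hwX i).1, (hP.1.2 i).2⟩
    · rw [Fin.snoc_last, ← Fin.castSucc_zero, Fin.snoc_castSucc, h0]
    · intro i j hij
      exact hP.2 (by simpa using hij)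
    · intro i j hij
      induction i using Fin.lastCases with
      | last =>
        induction j using Fin.lastCases with
        | last => rfl
        | cast j => exact absurd (by simpa using hij.symm) (hwX j).2
      | cast i =>
        induction j using Fin.lastCases with
        | last => exact absurd (by simpa using hij) (hwX i).2
        | cast j => exact congrArg Fin.castSucc (hP.edge_injective (by simpa using hij))
  · rintro h n u w ⟨hw, hn, hlast, -, hinj⟩
    obtain ⟨m, rfl⟩ : ∃ m, n = m + 1 := ⟨n - 1, by omega⟩
    have key : ∀ i : Fin (m + 1), G.Joined (X \ {w 0}) (u (Fin.succ 0)) (u i.succ) := by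
      intro i
      induction i using Fin.induction with
      | zero => exact .refl
      | succ i ih =>
        have := hw.2 i.succ
        refine ih.trans (.single ⟨this.1, fun h0 => ?_⟩ this.2)
        exact Fin.succ_ne_zero i (hinj h0)
    have h0 := hw.2 0
    refine h (w 0) h0.1 _ _ h0.2 ?_
    have := key (Fin.last m)
    rw [Fin.succ_last, hlast] at this
    exact this.symm

lemma isSpanningTree_iff :
    G.IsSpanningTree X ↔ X ⊆ E(G) ∧ V(G).Nonempty ∧
      (∀ a ∈ V(G), ∀ b ∈ V(G), G.Joined X a b) ∧ G.EdgeAcyclic X := by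
  rw [IsSpanningTree, isConnected_restrict_iff, isForest_restrict_iff, and_assoc]

end

/-! ### Sequences of exchanges -/

/-- The pairs of edge sets, with one edge left over, that arise from `A₀`, `B₀` and `f` by
exchanging the edge left over for an edge of its fundamental cycle in one of the two sets. -/
inductive ExchangeReach (H : Graph α β) (A₀ B₀ : Set β) (f : β) : Set β → Set β → β → Prop
  | base : ExchangeReach H A₀ B₀ f A₀ B₀ f
  | left {A B : Set β} {e g : β} {p q : α} (h : ExchangeReach H A₀ B₀ f A B e)
      (he : H.IsLink e p q) (hg : g ∈ A) (hn : ¬ H.Joined (A \ {g}) p q) :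
      ExchangeReach H A₀ B₀ f (insert e (A \ {g})) B g
  | right {A B : Set β} {e g : β} {p q : α} (h : ExchangeReach H A₀ B₀ f A B e)
      (he : H.IsLink e p q) (hg : g ∈ B) (hn : ¬ H.Joined (B \ {g}) p q) :
      ExchangeReach H A₀ B₀ f A (insert e (B \ {g})) g

/-- The edges that can be left over after a sequence of exchanges. -/
def exchangeSet (H : Graph α β) (A₀ B₀ : Set β) (f : β) : Set β :=
  {e | ∃ A B, H.ExchangeReach A₀ B₀ f A B e}

/-- The edge set of `H` is the disjoint union of `A`, `B` and `{e}`. -/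
def IsPartition (H : Graph α β) (A B : Set β) (e : β) : Prop :=
  Disjoint A B ∧ e ∉ A ∧ e ∉ B ∧ insert e (A ∪ B) = E(H)

section

variable {H : Graph α β} {A B A₀ B₀ F : Set β} {f e g : β} {p q : α}

lemma IsPartition.symm (h : H.IsPartition A B e) : H.IsPartition B A e :=
  ⟨h.1.symm, h.2.2.1, h.2.1, by rw [Set.union_comm]; exact h.2.2.2⟩

lemma IsPartition.exchange (h : H.IsPartition A B e) (hg : g ∈ A) :
    H.IsPartition (insert e (A \ {g})) B g := by
  obtain ⟨hd, heA, heB, hE⟩ := h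
  have hgB : g ∉ B := fun hB => Set.disjoint_left.1 hd hg hB
  have hge : g ≠ e := fun h => heA (h ▸ hg)
  refine ⟨?_, by simp [hge], hgB, ?_⟩
  · rw [Set.disjoint_left]
    rintro x (rfl | hx) hB
    exacts [heB hB, Set.disjoint_left.1 hd hx.1 hB]
  · rw [← hE]
    ext x
    simp only [Set.mem_insert_iff, Set.mem_union, Set.mem_sdiff, Set.mem_singleton_iff]
    by_cases hx : x = g
    · simp [hx, hg]
    · simp [hx, or_assoc]

/-- `A` arises from `A₀` by exchanges that keep the joined vertices, also within `F`. -/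
structure SameJoins (H : Graph α β) (F A₀ A : Set β) : Prop where
  acyclic : H.EdgeAcyclic A
  joined_iff : ∀ a b, H.Joined A a b ↔ H.Joined A₀ a b
  joined_inter_iff : ∀ a b, H.Joined (A ∩ F) a b ↔ H.Joined (A₀ ∩ F) a b

/-- By `hF`, the whole fundamental cycle of `e` in `A` lies in `F`. So the same exchange takes place
in `A ∩ F`, and `Joined.exchange_iff` applies to both sets. -/
lemma SameJoins.exchange (h : H.SameJoins F A₀ A) (hfin : A.Finite) (hAE : A ⊆ E(H))
    (he : H.IsLink e p q) (heF : e ∈ F) (hpq : H.Joined A p q)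
    (hF : ∀ g ∈ A, ¬ H.Joined (A \ {g}) p q → g ∈ F)
    (hg : g ∈ A) (hn : ¬ H.Joined (A \ {g}) p q) :
    H.SameJoins F A₀ (insert e (A \ {g})) := by
  obtain ⟨s, t, hst⟩ := H.exists_isLink_of_mem_edgeSet (hAE hg)
  refine ⟨(h.acyclic.mono Set.sdiff_subset).insert he hn, fun a b => ?_, fun a b => ?_⟩
  · rw [Joined.exchange_iff he hst hg hpq hn]
    exact h.joined_iff a b
  · have hset : insert e (A \ {g}) ∩ F = insert e ((A ∩ F) \ {g}) := by
      rw [Set.insert_inter_of_mem heF, Set.sdiff_inter_right_comm]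
    have hgF : g ∈ A ∩ F := ⟨hg, hF g hg hn⟩
    rw [hset, Joined.exchange_iff he hst hgF, h.joined_inter_iff]
    · exact (h.acyclic.joined_needed hfin hAE hpq).mono fun x hx => ⟨hx.1, hF x hx.1 hx.2⟩
    · exact fun hj => hn (hj.mono (Set.sdiff_subset_sdiff_left Set.inter_subset_left))

/-- As long as the edge left over has its ends joined in both sets, the exchanges keep the joined
vertices. -/
lemma ExchangeReach.invariant (hfin : E(H).Finite) (hP : H.IsPartition A₀ B₀ f)
    (hA : H.EdgeAcyclic A₀) (hB : H.EdgeAcyclic B₀)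
    (hJ : ∀ A B e, H.IsPartition A B e → H.SameJoins (H.exchangeSet A₀ B₀ f) A₀ A →
      H.SameJoins (H.exchangeSet A₀ B₀ f) B₀ B → ∀ p q, H.IsLink e p q →
      H.Joined A p q ∧ H.Joined B p q)
    (h : H.ExchangeReach A₀ B₀ f A B e) :
    H.IsPartition A B e ∧ H.SameJoins (H.exchangeSet A₀ B₀ f) A₀ A ∧
      H.SameJoins (H.exchangeSet A₀ B₀ f) B₀ B := by
  induction h with
  | base => exact ⟨hP, ⟨hA, by simp, by simp⟩, ⟨hB, by simp, by simp⟩⟩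
  | @left A B e g p q h he hg hn ih =>
    obtain ⟨hPAB, hSA, hSB⟩ := ih
    have hAE : A ⊆ E(H) := by
      rw [← hPAB.2.2.2]
      exact Set.subset_union_left.trans (Set.subset_insert _ _)
    have heF : e ∈ H.exchangeSet A₀ B₀ f := ⟨A, B, h⟩
    refine ⟨hPAB.exchange hg, ?_, hSB⟩
    -- Every edge of the fundamental cycle could have been exchanged instead of `g`, so it lies in
    -- the exchange set as well.
    exact hSA.exchange (hfin.subset hAE) hAE he heF
      (hJ A B e hPAB hSA hSB p q he).1
      (fun g' hg' hn' => ⟨_, _, h.left he hg' hn'⟩) hg hn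
  | @right A B e g p q h he hg hn ih =>
    obtain ⟨hPAB, hSA, hSB⟩ := ih
    have hBE : B ⊆ E(H) := by
      rw [← hPAB.2.2.2]
      exact Set.subset_union_right.trans (Set.subset_insert _ _)
    have heF : e ∈ H.exchangeSet A₀ B₀ f := ⟨A, B, h⟩
    refine ⟨(hPAB.symm.exchange hg).symm, hSA, ?_⟩
    exact hSB.exchange (hfin.subset hBE) hBE he heF
      (hJ A B e hPAB hSA hSB p q he).2
      (fun g' hg' hn' => ⟨_, _, h.right he hg' hn'⟩) hg hn

/-- As long as the edge left over has its ends joined in both sets, then its ends are even joined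
by the exchangeable edges of both sets. -/
lemma joined_inter_exchangeSet (hfin : E(H).Finite) (hP : H.IsPartition A₀ B₀ f)
    (hA : H.EdgeAcyclic A₀) (hB : H.EdgeAcyclic B₀)
    (hJ : ∀ A B e, H.IsPartition A B e → H.SameJoins (H.exchangeSet A₀ B₀ f) A₀ A →
      H.SameJoins (H.exchangeSet A₀ B₀ f) B₀ B → ∀ p q, H.IsLink e p q →
      H.Joined A p q ∧ H.Joined B p q)
    (he : e ∈ H.exchangeSet A₀ B₀ f) (hl : H.IsLink e p q) :
    H.Joined (A₀ ∩ H.exchangeSet A₀ B₀ f) p q ∧ H.Joined (B₀ ∩ H.exchangeSet A₀ B₀ f) p q := by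
  obtain ⟨A, B, h⟩ := id he
  obtain ⟨hPAB, hSA, hSB⟩ := h.invariant hfin hP hA hB hJ
  have hAE : A ⊆ E(H) := by
    rw [← hPAB.2.2.2]
    exact Set.subset_union_left.trans (Set.subset_insert _ _)
  have hBE : B ⊆ E(H) := by
    rw [← hPAB.2.2.2]
    exact Set.subset_union_right.trans (Set.subset_insert _ _)
  -- The claim is moved to the moment when `e` is left over: there the two paths between its ends
  -- consist of edges that the next exchange can release.
  rw [← hSA.joined_inter_iff, ← hSB.joined_inter_iff]
  constructor
  · refine (hSA.acyclic.joined_needed (hfin.subset hAE) hAE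
      (hJ A B e hPAB hSA hSB p q hl).1).mono fun g hg => ⟨hg.1, ?_⟩
    exact ⟨_, _, h.left hl hg.1 hg.2⟩
  · refine (hSB.acyclic.joined_needed (hfin.subset hBE) hBE
      (hJ A B e hPAB hSA hSB p q hl).2).mono fun g hg => ⟨hg.1, ?_⟩
    exact ⟨_, _, h.right hl hg.1 hg.2⟩


/-! ### The dichotomy and the bispanning subgraph it yields -/

/-- A spanning tree and a forest with at most two components, together with one more edge, either
make up a bispanning graph, or they have subsets that join the same vertices, among them the ends
of that edge. -/
lemma IsPartition.isBispanning_or_exists (hfin : E(H).Finite) (hP : H.IsPartition A₀ B₀ f)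
    (hV : V(H).Nonempty) (hA : H.EdgeAcyclic A₀) (hB : H.EdgeAcyclic B₀)
    (hAc : ∀ a ∈ V(H), ∀ b ∈ V(H), H.Joined A₀ a b) {r s : α}
    (hBc : ∀ a ∈ V(H), H.Joined B₀ r a ∨ H.Joined B₀ s a) :
    H.IsBispanning ∨ ∃ A ⊆ A₀, ∃ B ⊆ B₀, (∀ p q, H.Joined A p q ↔ H.Joined B p q) ∧
      ∀ p q, H.IsLink f p q → H.Joined A p q := by
  by_cases hH : H.IsBispanning
  · exact Or.inl hH
  have hJ : ∀ A B e, H.IsPartition A B e → H.SameJoins (H.exchangeSet A₀ B₀ f) A₀ A →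
      H.SameJoins (H.exchangeSet A₀ B₀ f) B₀ B → ∀ p q, H.IsLink e p q →
      H.Joined A p q ∧ H.Joined B p q := by
    intro A B e hP hSA hSB p q hl
    have hAc' : ∀ a ∈ V(H), ∀ b ∈ V(H), H.Joined A a b := fun a ha b hb =>
      (hSA.joined_iff a b).2 (hAc a ha b hb)
    refine ⟨hAc' p hl.left_mem q hl.right_mem, ?_⟩
    -- Otherwise `e` would connect the components of `B`, and `A` and `insert e B` would be disjoint
    -- spanning trees.
    by_contra hn
    have hBc' : ∀ a ∈ V(H), H.Joined B r a ∨ H.Joined B s a := fun a ha =>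
      (hBc a ha).imp (hSB.joined_iff _ _).2 (hSB.joined_iff _ _).2
    have hs := Set.subset_insert e B
    have hpq : H.Joined (insert e B) p q := .single (Set.mem_insert _ _) hl
    have hrs : H.Joined (insert e B) r s := by
      rcases hBc' p hl.left_mem with h1 | h1 <;> rcases hBc' q hl.right_mem with h2 | h2
      · exact absurd (h1.symm.trans h2) hn
      · exact ((h1.mono hs).trans hpq).trans (h2.mono hs).symm
      · exact ((h2.mono hs).trans hpq.symm).trans (h1.mono hs).symm
      · exact absurd (h1.symm.trans h2) hn
    have hr : ∀ a ∈ V(H), H.Joined (insert e B) r a := fun a ha =>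
      (hBc' a ha).elim (Joined.mono hs) fun h => hrs.trans (h.mono hs)
    obtain ⟨hd, heA, heB, hE⟩ := hP
    refine hH ⟨A, insert e B, isSpanningTree_iff.2 ⟨?_, hV, hAc', hSA.acyclic⟩,
      isSpanningTree_iff.2 ⟨?_, hV, fun a ha b hb => (hr a ha).symm.trans (hr b hb),
        hSB.acyclic.insert hl hn⟩, ?_, ?_⟩
    · exact hE ▸ Set.subset_union_left.trans (Set.subset_insert _ _)
    · exact hE ▸ Set.insert_subset_insert Set.subset_union_right
    · rw [Set.union_insert, hE]
    · rw [Set.inter_insert_of_notMem heA, hd.inter_eq]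
  have key {e p q} (he : e ∈ H.exchangeSet A₀ B₀ f) (hl : H.IsLink e p q) :=
    joined_inter_exchangeSet hfin hP hA hB hJ he hl
  -- An edge of either intersection can itself be left over, so `key` joins its ends within the
  -- other intersection; for `f` this is the empty sequence of exchanges.
  refine Or.inr ⟨A₀ ∩ H.exchangeSet A₀ B₀ f, Set.inter_subset_left,
    B₀ ∩ H.exchangeSet A₀ B₀ f, Set.inter_subset_left, fun p q => ⟨fun h => ?_,
    fun h => ?_⟩, fun p q hl => (key ⟨_, _, .base⟩ hl).1⟩
  · exact h.lift fun e he _ _ hl => (key he.2 hl).2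
  · exact h.lift fun e he _ _ hl => (key he.2 hl).1

/-- Two disjoint acyclic sets of edges that join the same vertices span a bispanning subgraph on
each of their components. -/
lemma exists_isBispanning_subgraph {G : Graph α β} {a : α} (ha : a ∈ V(G)) (hAE : A ⊆ E(G))
    (hBE : B ⊆ E(G)) (hd : Disjoint A B) (hA : G.EdgeAcyclic A) (hB : G.EdgeAcyclic B)
    (hAB : ∀ p q, G.Joined A p q ↔ G.Joined B p q) :
    ∃ K ≤ G, K.IsBispanning ∧ V(K) = {b | G.Joined A a b} ∧ E(K) ⊆ A ∪ B := by
  let X : Set α := {b | G.Joined A a b}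
  let K : Graph α β := (G.restrict (A ∪ B)).induce X
  have hXV : X ⊆ V(G) := fun b hb => hb.mem ha
  have hKG : K ≤ G := (induce_le (G := G.restrict (A ∪ B)) hXV).trans restrict_le
  have hlink {e p q} : K.IsLink e p q ↔
      (e ∈ A ∪ B ∧ G.IsLink e p q) ∧ p ∈ X ∧ q ∈ X := Iff.rfl
  have tree : ∀ C ⊆ A ∪ B, C ⊆ E(G) → G.EdgeAcyclic C → (∀ p q, G.Joined A p q ↔ G.Joined C p q) →
      K.IsSpanningTree (C ∩ E(K)) := by
    intro C hC hCE hCa hCj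
    refine isSpanningTree_iff.2 ⟨Set.inter_subset_right, ⟨a, Joined.refl⟩, ?_,
      (hCa.mono Set.inter_subset_left).congr fun e _ p q h => h.mono hKG⟩
    -- A walk from `a` with edges in `C` never leaves `X`, because `C` and `A` join the same
    -- vertices; so its edges survive in `K`.
    have hj : ∀ b ∈ X, K.Joined (C ∩ E(K)) a b := by
      intro b hb
      have hb' : G.Joined C a b := (hCj a b).1 hb
      clear hb
      induction hb' with
      | refl => exact .refl
      | @tail c d hac hcd ih =>
        obtain ⟨e, he, hl⟩ := hcd
        have hc : c ∈ X := (hCj a c).2 hac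
        have hd : d ∈ X := (hCj a d).2 (hac.trans (Joined.single he hl))
        have hK : K.IsLink e c d := hlink.2 ⟨⟨hC he, hl⟩, hc, hd⟩
        exact ih.trans (.single ⟨he, hK.edge_mem⟩ hK)
    exact fun b hb c hc => (hj b hb).symm.trans (hj c hc)
  have hEK : E(K) ⊆ A ∪ B := by
    intro e he
    obtain ⟨p, q, h⟩ := K.exists_isLink_of_mem_edgeSet he
    exact (hlink.1 h).1.1
  refine ⟨K, hKG, ⟨A ∩ E(K), B ∩ E(K), tree A Set.subset_union_left hAE hA fun _ _ => Iff.rfl,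
    tree B Set.subset_union_right hBE hB hAB, ?_, ?_⟩, rfl, hEK⟩
  · rwa [← Set.union_inter_distrib_right, Set.inter_eq_right]
  · rw [← Set.inter_inter_distrib_right, hd.inter_eq, Set.empty_inter]

end

/-! ### Contraction and edge-split-attach at a vertex of degree three -/

/-- The loopless graph `G` has exactly the three edges `ea`, `eb`, `ec` at `v`, and they lead to
the distinct vertices `a`, `b`, `c`. -/
structure IsClawAt (G : Graph α β) (v a b c : α) (ea eb ec : β) : Prop where
  not_loop : ∀ e w, ¬ G.IsLink e w w
  isLink_iff : ∀ e w, G.IsLink e v w ↔ (e = ea ∧ w = a) ∨ (e = eb ∧ w = b) ∨ (e = ec ∧ w = c)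
  ne_ab : a ≠ b
  ne_ac : a ≠ c
  ne_bc : b ≠ c

section

variable {G : Graph α β} {v a b c p q w : α} {ea eb ec e f : β} {S T X : Set β}

lemma deleteVerts_singleton_isLink :
    (G.deleteVerts {v}).IsLink e p q ↔ G.IsLink e p q ∧ p ≠ v ∧ q ≠ v := by
  simp [deleteVerts_isLink]

namespace IsClawAt

/-- Together with `swap_right` this yields all orders of the neighbours, so that later facts need a
proof for one edge only. -/
lemma swap_left (h : G.IsClawAt v a b c ea eb ec) :
    G.IsClawAt v b a c eb ea ec :=
  ⟨h.not_loop, fun e w => by rw [h.isLink_iff]; tauto, h.ne_ab.symm, h.ne_bc, h.ne_ac⟩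

lemma swap_right (h : G.IsClawAt v a b c ea eb ec) :
    G.IsClawAt v a c b ea ec eb :=
  ⟨h.not_loop, fun e w => by rw [h.isLink_iff]; tauto, h.ne_ac, h.ne_ab, h.ne_bc.symm⟩

lemma link_a (h : G.IsClawAt v a b c ea eb ec) : G.IsLink ea v a :=
  (h.isLink_iff _ _).2 (Or.inl ⟨rfl, rfl⟩)
lemma link_b (h : G.IsClawAt v a b c ea eb ec) : G.IsLink eb v b := h.swap_left.link_a
lemma link_c (h : G.IsClawAt v a b c ea eb ec) : G.IsLink ec v c := h.swap_right.link_b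

lemma ne_a (h : G.IsClawAt v a b c ea eb ec) : a ≠ v :=
  fun hv => h.not_loop ea v (hv ▸ h.link_a)
lemma ne_b (h : G.IsClawAt v a b c ea eb ec) : b ≠ v := h.swap_left.ne_a
lemma ne_c (h : G.IsClawAt v a b c ea eb ec) : c ≠ v := h.swap_right.ne_b

lemma edge_ne_ab (h : G.IsClawAt v a b c ea eb ec) : ea ≠ eb :=
  fun he => h.ne_ab (h.link_a.right_unique (he ▸ h.link_b))
lemma edge_ne_ac (h : G.IsClawAt v a b c ea eb ec) : ea ≠ ec := h.swap_right.edge_ne_ab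
lemma edge_ne_bc (h : G.IsClawAt v a b c ea eb ec) : eb ≠ ec := h.swap_left.edge_ne_ac

lemma notMem_deleteVerts (h : G.IsClawAt v a b c ea eb ec) : ea ∉ E(G.deleteVerts {v}) := by
  intro he
  obtain ⟨p, q, hl⟩ := exists_isLink_of_mem_edgeSet he
  rw [deleteVerts_singleton_isLink] at hl
  rcases h.link_a.left_eq_or_eq hl.1 with h1 | h1
  exacts [hl.2.1 h1.symm, hl.2.2 h1.symm]

/-- Contracting one of the three edges and deleting another one replaces the vertex by an edge. -/
lemma contract_deleteEdges_eq (h : G.IsClawAt v a b c ea eb ec) :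
    (G.contract {v, a} a).deleteEdges {ec} = (G.deleteVerts {v}).addEdge eb a b := by
  have hv := h.link_a.left_mem
  -- The classical instance matches the one in `contract`, so that the unfoldings below hold by
  -- definition.
  let σ : α → α := fun u => @ite _ (u ∈ ({v, a} : Set α)) (Classical.propDecidable _) a u
  have hσv : σ v = a := if_pos (Or.inl rfl)
  have hid : ∀ u, u ≠ v → σ u = u := by
    intro u hu
    by_cases hua : u = a
    · subst hua
      exact if_pos (Or.inr rfl)
    · exact if_neg fun hc => hc.elim hu hua
  refine Graph.ext ?_ fun e p q => ?_
  · change σ '' V(G) = V(G.deleteVerts {v}) ∪ {a, b}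
    rw [vertexSet_deleteVerts]
    ext w
    constructor
    · rintro ⟨u, hu, rfl⟩
      by_cases huv : u = v
      · exact Or.inr (Or.inl (huv ▸ hσv))
      · exact Or.inl (by rw [hid u huv]; exact ⟨hu, huv⟩)
    · rintro (⟨hw, hwv⟩ | rfl | rfl)
      exacts [⟨w, hw, hid w hwv⟩, ⟨v, hv, hσv⟩, ⟨w, h.link_b.right_mem, hid w h.ne_b⟩]
  · have hiff : ((G.contract {v, a} a).deleteEdges {ec}).IsLink e p q ↔
        (∃ p' q', (G.IsLink e p' q' ∧ ¬ ∃ s ∈ ({v, a} : Set α), ∃ t ∈ ({v, a} : Set α),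
          G.IsLink e s t) ∧ σ p' = p ∧ σ q' = q) ∧ e ≠ ec := Iff.rfl
    have hiff' : ((G.deleteVerts {v}).addEdge eb a b).IsLink e p q ↔
        (e ≠ eb ∧ (G.deleteVerts {v}).IsLink e p q) ∨
          (e = eb ∧ ((p = a ∧ q = b) ∨ (p = b ∧ q = a))) := Iff.rfl
    rw [hiff, hiff', deleteVerts_singleton_isLink]
    constructor
    · rintro ⟨⟨p', q', ⟨hl, hn⟩, rfl, rfl⟩, hec⟩
      have hea : e ≠ ea := by
        rintro rfl
        exact hn ⟨v, by simp, a, by simp, h.link_a⟩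
      -- The only edge at `v` that survives is `eb`, since `ea` is contracted and `ec` deleted.
      by_cases hp : p' = v
      · subst hp
        obtain ⟨rfl, rfl⟩ := (((h.isLink_iff _ _).1 hl).resolve_left
          fun h' => hea h'.1).resolve_right fun h' => hec h'.1
        rw [hσv, hid _ h.ne_b]
        exact Or.inr ⟨rfl, Or.inl ⟨rfl, rfl⟩⟩
      by_cases hq : q' = v
      · subst hq
        obtain ⟨rfl, rfl⟩ := (((h.isLink_iff _ _).1 hl.symm).resolve_left
          fun h' => hea h'.1).resolve_right fun h' => hec h'.1
        rw [hσv, hid _ h.ne_b]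
        exact Or.inr ⟨rfl, Or.inr ⟨rfl, rfl⟩⟩
      rw [hid _ hp, hid _ hq]
      refine Or.inl ⟨?_, hl, hp, hq⟩
      rintro rfl
      rcases h.link_b.left_eq_or_eq hl with h' | h'
      exacts [hp h'.symm, hq h'.symm]
    · rintro (⟨-, hl, hp, hq⟩ | ⟨rfl, hpq⟩)
      · refine ⟨⟨p, q, ⟨hl, ?_⟩, hid p hp, hid q hq⟩, ?_⟩
        -- A removed edge that avoids `v` would be a loop at `a`.
        · rintro ⟨s, hs, t, ht, hst⟩
          obtain ⟨rfl, rfl⟩ | ⟨rfl, rfl⟩ := hst.eq_and_eq_or_eq_and_eq hl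
          · obtain rfl := hs.resolve_left hp
            obtain rfl := ht.resolve_left hq
            exact h.not_loop _ _ hst
          · obtain rfl := hs.resolve_left hq
            obtain rfl := ht.resolve_left hp
            exact h.not_loop _ _ hst
        · rintro rfl
          rcases h.link_c.left_eq_or_eq hl with h' | h'
          exacts [hp h'.symm, hq h'.symm]
      · have hn : ¬ ∃ s ∈ ({v, a} : Set α), ∃ t ∈ ({v, a} : Set α), G.IsLink e s t := by
          rintro ⟨s, hs, t, ht, hst⟩
          have hb : b ∈ ({v, a} : Set α) := by
            rcases h.link_b.right_eq_or_eq hst with rfl | rfl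
            exacts [hs, ht]
          exact hb.elim h.ne_b h.ne_ab.symm
        rcases hpq with ⟨rfl, rfl⟩ | ⟨rfl, rfl⟩
        · exact ⟨⟨v, q, ⟨h.link_b, hn⟩, hσv, hid q h.ne_b⟩, h.edge_ne_bc⟩
        · exact ⟨⟨p, v, ⟨h.link_b.symm, hn⟩, hid p h.ne_b, hσv⟩, h.edge_ne_bc⟩

/-- Splitting the edge that replaces `v` and attaching `v` gives back the graph. -/
lemma isEdgeSplitAttach (h : G.IsClawAt v a b c ea eb ec)
    (hf : f ∉ E(G.deleteVerts {v})) :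
    IsEdgeSplitAttach ((G.deleteVerts {v}).addEdge f a b) G f a b c v ea eb ec := by
  have hE : E((G.deleteVerts {v}).addEdge f a b) \ {f} = E(G.deleteVerts {v}) := by
    change (E(G.deleteVerts {v}) ∪ {f}) \ {f} = _
    rw [Set.union_sdiff_right, Set.sdiff_singleton_eq_self hf]
  have hV : V((G.deleteVerts {v}).addEdge f a b) = V(G) \ {v} := by
    change V(G.deleteVerts {v}) ∪ {a, b} = _
    rw [vertexSet_deleteVerts, Set.union_eq_left]
    rintro w (rfl | rfl)
    exacts [⟨h.link_a.right_mem, h.ne_a⟩, ⟨h.link_b.right_mem, h.ne_b⟩]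
  have hc := h.link_c.right_mem
  refine ⟨Or.inr ⟨rfl, Or.inl ⟨rfl, rfl⟩⟩, hV ▸ ⟨hc, h.ne_c⟩, by simp [hV],
    hE ▸ h.notMem_deleteVerts, hE ▸ h.swap_left.notMem_deleteVerts,
    hE ▸ h.swap_right.swap_left.notMem_deleteVerts, h.edge_ne_ab, h.edge_ne_ac, h.edge_ne_bc, ?_⟩
  refine Graph.ext ?_ fun e p q => ?_
  · change V(G) = ((V((G.deleteVerts {v}).addEdge f a b) ∪ {a, v}) ∪ {b, v}) ∪ {c, v}
    rw [hV]
    ext w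
    have h1 := h.link_a.left_mem
    have h2 := h.link_a.right_mem
    have h3 := h.link_b.right_mem
    simp only [Set.mem_union, Set.mem_sdiff, Set.mem_insert_iff, Set.mem_singleton_iff]
    constructor
    · tauto
    · rintro (((h' | rfl | rfl) | rfl | rfl) | rfl | rfl)
      exacts [h'.1, h2, h1, h3, h1, hc, h1]
  · change G.IsLink e p q ↔ (e ≠ ec ∧ ((e ≠ eb ∧ ((e ≠ ea ∧ (((e ≠ f ∧
      (G.deleteVerts {v}).IsLink e p q) ∨ (e = f ∧ ((p = a ∧ q = b) ∨ (p = b ∧ q = a)))) ∧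
      e ∉ ({f} : Set β))) ∨
      (e = ea ∧ ((p = a ∧ q = v) ∨ (p = v ∧ q = a))))) ∨
      (e = eb ∧ ((p = b ∧ q = v) ∨ (p = v ∧ q = b))))) ∨
      (e = ec ∧ ((p = c ∧ q = v) ∨ (p = v ∧ q = c)))
    have hfl : (G.deleteVerts {v}).IsLink e p q → e ≠ f := fun hl he => hf (he ▸ hl.edge_mem)
    rw [Set.mem_singleton_iff]
    -- The cases go from the edge added last to the one added first. The name `f` may be `ea` or
    -- `eb`, so these are treated before `f`.
    by_cases h3 : e = ec
    · subst h3
      simp [h.link_c.isLink_iff, h.edge_ne_bc.symm, h.edge_ne_ac.symm]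
      tauto
    by_cases h2 : e = eb
    · subst h2
      simp [h.link_b.isLink_iff, h3, h.edge_ne_ab.symm]
      tauto
    by_cases h1 : e = ea
    · subst h1
      simp [h.link_a.isLink_iff, h3, h2]
      tauto
    have hl : G.IsLink e p q ↔ (G.deleteVerts {v}).IsLink e p q := by
      rw [deleteVerts_singleton_isLink]
      refine ⟨fun hl => ⟨hl, ?_, ?_⟩, fun hl => hl.1⟩
      · rintro rfl
        have := (h.isLink_iff e q).1 hl
        tauto
      · rintro rfl
        have := (h.isLink_iff e p).1 hl.symm
        tauto
    simp only [h1, h2, h3, hl, ne_eq, not_false_eq_true, true_and, false_and, or_false]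
    constructor
    · exact fun hl => ⟨Or.inl ⟨hfl hl, hl⟩, hfl hl⟩
    · exact fun hl => (hl.1.resolve_right fun h' => hl.2 h'.1).2

end IsClawAt
end

/-! ### The reduction is bispanning -/

section

variable {G : Graph α β} {v a b c p q w : α} {ea eb ec e f : β} {S T X : Set β}

/-- A walk that starts at `v` can be continued after its last visit to `v` without using edges
at `v`. -/
lemma Joined.exists_joined_deleteVerts (h : G.Joined T v w) :
    w = v ∨ ∃ e ∈ T, ∃ p, G.IsLink e v p ∧ G.Joined (T ∩ E(G.deleteVerts {v})) p w := by
  induction h with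
  | refl => exact Or.inl rfl
  | @tail b c _ h ih =>
    obtain ⟨e, he, hl⟩ := h
    by_cases hc : c = v
    · exact Or.inl hc
    by_cases hb : b = v
    · subst hb
      exact Or.inr ⟨e, he, c, hl, .refl⟩
    · obtain ⟨g, hg, p, hlp, hj⟩ := ih.resolve_left hb
      have hl' : (G.deleteVerts {v}).IsLink e b c := deleteVerts_singleton_isLink.2 ⟨hl, hb, hc⟩
      exact Or.inr ⟨g, hg, p, hlp, hj.trans (.single ⟨he, hl'.edge_mem⟩ hl)⟩

lemma IsBispanning.not_isLink_self (h : G.IsBispanning) : ¬ G.IsLink e w w := by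
  obtain ⟨S, T, hS, hT, hU, -⟩ := h
  intro hl
  rcases (hU ▸ hl.edge_mem : e ∈ S ∪ T) with he | he
  · exact (isSpanningTree_iff.1 hS).2.2.2 e he w w hl .refl
  · exact (isSpanningTree_iff.1 hT).2.2.2 e he w w hl .refl

/-- The reduction at a vertex of degree three, for given trees. -/
lemma IsClawAt.isBispanning_addEdge_of_isSpanningTree (h : G.IsClawAt v a b c ea eb ec)
    (hE : E(G).Finite) (hG : G.IsAtomicBispanning) (hf : f ∉ E(G.deleteVerts {v}))
    (hS : G.IsSpanningTree S) (hT : G.IsSpanningTree T) (hU : S ∪ T = E(G)) (hI : S ∩ T = ∅)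
    (hSv : ∃ p, ∀ e ∈ S, ∀ w, G.IsLink e v w → w = p)
    (hTv : ∃ p q, ∀ e ∈ T, ∀ w, G.IsLink e v w → w = p ∨ w = q) :
    ((G.deleteVerts {v}).addEdge f a b).IsBispanning := by
  rw [isSpanningTree_iff] at hS hT
  obtain ⟨hSE, -, hSc, hSa⟩ := hS
  obtain ⟨hTE, -, hTc, hTa⟩ := hT
  obtain ⟨r, hr⟩ := hSv
  obtain ⟨s, t, hst⟩ := hTv
  have hv := h.link_a.left_mem
  set D := G.deleteVerts {v} with hD
  set H := D.addEdge f a b with hH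
  have hHE : E(H) = E(D) ∪ {f} := rfl
  have hV : ∀ w, w ∈ V(H) ↔ w ∈ V(G) ∧ w ≠ v := by
    intro w
    change w ∈ V(G.deleteVerts {v}) ∪ {a, b} ↔ _
    rw [vertexSet_deleteVerts]
    constructor
    · rintro (hw | rfl | rfl)
      exacts [hw, ⟨h.link_a.right_mem, h.ne_a⟩, ⟨h.link_b.right_mem, h.ne_b⟩]
    · exact fun hw => Or.inl hw
  have hlink : ∀ e ∈ E(D), ∀ p q, H.IsLink e p q ↔ G.IsLink e p q := by
    intro e he p q
    have hef : e ≠ f := fun h' => hf (h' ▸ he)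
    change (e ≠ f ∧ D.IsLink e p q) ∨ (e = f ∧ _) ↔ _
    rw [deleteVerts_le.isLink_iff he]
    simp [hef]
  have hjoin : ∀ X ⊆ E(D), ∀ p q, H.Joined X p q ↔ G.Joined X p q := fun X hX p q =>
    ⟨fun hj => hj.lift fun e he _ _ hl => .single he ((hlink e (hX he) _ _).1 hl),
      fun hj => hj.lift fun e he _ _ hl => .single he ((hlink e (hX he) _ _).2 hl)⟩
  have hP : H.IsPartition (S ∩ E(D)) (T ∩ E(D)) f := by
    refine ⟨(Set.disjoint_iff_inter_eq_empty.2 hI).mono Set.inter_subset_left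
      Set.inter_subset_left, fun h' => hf h'.2, fun h' => hf h'.2, ?_⟩
    rw [← Set.union_inter_distrib_right, hU, Set.inter_eq_right.2 deleteVerts_le.edgeSet_mono, hHE,
      Set.union_singleton]
  have hacyc : ∀ X, G.EdgeAcyclic X → H.EdgeAcyclic (X ∩ E(D)) := fun X hX =>
    (hX.mono Set.inter_subset_left).congr fun e he p q hl => (hlink e he.2 p q).1 hl
  have haH : a ∈ V(H) := (hV a).2 ⟨h.link_a.right_mem, h.ne_a⟩
  -- After its last visit to `v`, a walk in `S` continues from `r`; in `T` it continues from `s` or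
  -- `t`, whence at most two components.
  have hSr : ∀ w ∈ V(H), H.Joined (S ∩ E(D)) r w := by
    intro w hw
    obtain ⟨hwG, hwv⟩ := (hV w).1 hw
    obtain ⟨e, he, p, hl, hj⟩ := (hSc v hv w hwG).exists_joined_deleteVerts.resolve_left hwv
    rw [hjoin _ Set.inter_subset_right, ← hr e he p hl]
    exact hj
  have hTst : ∀ w ∈ V(H), H.Joined (T ∩ E(D)) s w ∨ H.Joined (T ∩ E(D)) t w := by
    intro w hw
    obtain ⟨hwG, hwv⟩ := (hV w).1 hw
    obtain ⟨e, he, p, hl, hj⟩ := (hTc v hv w hwG).exists_joined_deleteVerts.resolve_left hwv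
    rw [hjoin _ Set.inter_subset_right, hjoin _ Set.inter_subset_right]
    rcases hst e he p hl with rfl | rfl
    exacts [Or.inl hj, Or.inr hj]
  have hfin : E(H).Finite :=
    (hE.subset deleteVerts_le.edgeSet_mono).union (Set.finite_singleton f)
  rcases hP.isBispanning_or_exists hfin ⟨a, haH⟩ (hacyc S hSa) (hacyc T hTa)
    (fun p hp q hq => (hSr p hp).symm.trans (hSr q hq)) hTst with hb | ⟨A, hA, B, hB, hAB, hfAB⟩
  · exact hb
  -- The sets `A` and `B` lie in `G - v`, so the bispanning subgraph on the component of `a` misses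
  -- `v`. It also contains `b ≠ a`, so it is neither `G` nor a single vertex.
  exfalso
  have hAD := hA.trans Set.inter_subset_right
  have hBD := hB.trans Set.inter_subset_right
  have hAS := hA.trans Set.inter_subset_left
  have hBT := hB.trans Set.inter_subset_left
  obtain ⟨K, hKG, hK, hKV, -⟩ := exists_isBispanning_subgraph h.link_a.right_mem
    (hAS.trans hSE) (hBT.trans hTE) ((Set.disjoint_iff_inter_eq_empty.2 hI).mono hAS hBT)
    (hSa.mono hAS) (hTa.mono hBT)
    (fun p q => by rw [← hjoin A hAD, ← hjoin B hBD, hAB])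
  have haK : a ∈ V(K) := hKV ▸ (Joined.refl : G.Joined A a a)
  have hbK : b ∈ V(K) := hKV ▸
    ((hjoin A hAD a b).1 (hfAB a b (Or.inr ⟨rfl, Or.inl ⟨rfl, rfl⟩⟩)) : G.Joined A a b)
  rcases hG.2 K hKG hK with rfl | ⟨u, rfl⟩
  · have hj : K.Joined A a v := by rwa [hKV] at hv
    exact ((hV v).1 (((hjoin A hAD a v).2 hj).mem haH)).2 rfl
  · exact h.ne_ab (haK.trans hbK.symm)

/-- The reduction of an atomic bispanning graph at a vertex of degree three is bispanning. -/
lemma IsClawAt.isBispanning_addEdge (h : G.IsClawAt v a b c ea eb ec)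
    (hE : E(G).Finite) (hG : G.IsAtomicBispanning) (hf : f ∉ E(G.deleteVerts {v})) :
    ((G.deleteVerts {v}).addEdge f a b).IsBispanning := by
  obtain ⟨S, T, hS, hT, hU, hI⟩ := hG.1
  -- Each tree must reach `v`, so neither can take all three edges there.
  have one : ∀ S T : Set β, G.IsSpanningTree S → S ∩ T = ∅ → ¬ (ea ∈ T ∧ eb ∈ T ∧ ec ∈ T) := by
    rintro S T hS hI ⟨h1, h2, h3⟩
    obtain ⟨e, he, p, hl, -⟩ := ((isSpanningTree_iff.1 hS).2.2.1 v h.link_a.left_mem a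
      h.link_a.right_mem).exists_joined_deleteVerts.resolve_left h.ne_a
    have heT : e ∈ T := by
      rcases (h.isLink_iff e p).1 hl with ⟨rfl, -⟩ | ⟨rfl, -⟩ | ⟨rfl, -⟩ <;> assumption
    exact Set.notMem_empty e (hI ▸ ⟨he, heT⟩)
  have hS3 := one S T hS hI
  have hT3 := one T S hT (by rwa [Set.inter_comm])
  have hmem : ∀ e ∈ E(G), e ∈ S ∧ e ∉ T ∨ e ∈ T ∧ e ∉ S := by
    intro e he
    have hn : ¬ (e ∈ S ∧ e ∈ T) := fun h' => Set.notMem_empty e (hI ▸ h')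
    rcases (hU ▸ he : e ∈ S ∪ T) with h' | h'
    exacts [Or.inl ⟨h', fun h'' => hn ⟨h', h''⟩⟩, Or.inr ⟨h', fun h'' => hn ⟨h'', h'⟩⟩]
  have key := h.isBispanning_addEdge_of_isSpanningTree hE hG hf hS hT hU hI
  have key' := h.isBispanning_addEdge_of_isSpanningTree hE hG hf hT hS
    (by rwa [Set.union_comm]) (by rwa [Set.inter_comm])
  have few : ∀ (X : Set β) (p q : α), (ea ∈ X → a = p ∨ a = q) → (eb ∈ X → b = p ∨ b = q) →
      (ec ∈ X → c = p ∨ c = q) → ∀ e ∈ X, ∀ w, G.IsLink e v w → w = p ∨ w = q := by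
    intro X p q h1 h2 h3 e he w hl
    rcases (h.isLink_iff e w).1 hl with ⟨rfl, rfl⟩ | ⟨rfl, rfl⟩ | ⟨rfl, rfl⟩
    exacts [h1 he, h2 he, h3 he]
  -- The single neighbour is written as the pair `p`, `p`, so that `few` serves both trees.
  have fin {X Y : Set β} (p q r : α) (hX : ∀ e ∈ X, ∀ w, G.IsLink e v w → w = p ∨ w = p)
      (hY : ∀ e ∈ Y, ∀ w, G.IsLink e v w → w = q ∨ w = r)
      (hXY : (∃ p, ∀ e ∈ X, ∀ w, G.IsLink e v w → w = p) →
        (∃ p q, ∀ e ∈ Y, ∀ w, G.IsLink e v w → w = p ∨ w = q) →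
        ((G.deleteVerts {v}).addEdge f a b).IsBispanning) :
      ((G.deleteVerts {v}).addEdge f a b).IsBispanning :=
    hXY ⟨p, fun e he w hl => (hX e he w hl).elim id id⟩ ⟨q, r, hY⟩
  rcases hmem ea h.link_a.edge_mem with ⟨h1, h1'⟩ | ⟨h1, h1'⟩ <;>
  rcases hmem eb h.link_b.edge_mem with ⟨h2, h2'⟩ | ⟨h2, h2'⟩ <;>
  rcases hmem ec h.link_c.edge_mem with ⟨h3, h3'⟩ | ⟨h3, h3'⟩
  · exact absurd ⟨h1, h2, h3⟩ hT3
  · exact fin c a b (few _ _ _ (absurd · h1') (absurd · h2') (fun _ => .inl rfl))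
      (few _ _ _ (fun _ => .inl rfl) (fun _ => .inr rfl) (absurd · h3')) key'
  · exact fin b a c (few _ _ _ (absurd · h1') (fun _ => .inl rfl) (absurd · h3'))
      (few _ _ _ (fun _ => .inl rfl) (absurd · h2') (fun _ => .inr rfl)) key'
  · exact fin a b c (few _ _ _ (fun _ => .inl rfl) (absurd · h2') (absurd · h3'))
      (few _ _ _ (absurd · h1') (fun _ => .inl rfl) (fun _ => .inr rfl)) key
  · exact fin a b c (few _ _ _ (fun _ => .inl rfl) (absurd · h2') (absurd · h3'))
      (few _ _ _ (absurd · h1') (fun _ => .inl rfl) (fun _ => .inr rfl)) key'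
  · exact fin b a c (few _ _ _ (absurd · h1') (fun _ => .inl rfl) (absurd · h3'))
      (few _ _ _ (fun _ => .inl rfl) (absurd · h2') (fun _ => .inr rfl)) key
  · exact fin c a b (few _ _ _ (absurd · h1') (absurd · h2') (fun _ => .inl rfl))
      (few _ _ _ (fun _ => .inl rfl) (fun _ => .inr rfl) (absurd · h3')) key
  · exact absurd ⟨h1, h2, h3⟩ hS3

lemma addEdge_comm (G : Graph α β) (f : β) (a b : α) : G.addEdge f a b = G.addEdge f b a := by
  refine Graph.ext ?_ fun e p q => ?_
  · exact congrArg (V(G) ∪ ·) (Set.pair_comm a b)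
  · exact or_congr Iff.rfl (and_congr Iff.rfl Or.comm)

/-! ### Distinct neighbours -/

/-- In an atomic bispanning graph, only a vertex of degree at most two is incident to parallel
edges. -/
lemma IsAtomicBispanning.eq_of_isLink (hG : G.IsAtomicBispanning) (hdeg : 2 < G.degree v)
    (he : G.IsLink e v w) (hf : G.IsLink f v w) : e = f := by
  by_contra hef
  have hvw : v ≠ w := fun h => hG.1.not_isLink_self (e := e) (w := w) (h ▸ he)
  have acyc : ∀ g, G.IsLink g v w → G.EdgeAcyclic {g} := by
    rintro g hg _ rfl p q hl hj
    rw [Set.sdiff_self] at hj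
    have hpq : p = q := by
      induction hj with
      | refl => rfl
      | tail _ h _ => exact absurd h.choose_spec.1 (Set.notMem_empty _)
    exact hG.1.not_isLink_self (hpq ▸ hl)
  have join : ∀ g g', G.IsLink g v w → G.IsLink g' v w → ∀ p q,
      G.Joined {g} p q → G.Joined {g'} p q := by
    intro g g' hg hg' p q hj
    refine hj.lift ?_
    rintro _ rfl a b hl
    exact .single rfl (hg'.isLink_iff.2 (hg.isLink_iff.1 hl))
  obtain ⟨K, hKG, hK, hKV, hKE⟩ := exists_isBispanning_subgraph he.left_mem
    (Set.singleton_subset_iff.2 he.edge_mem) (Set.singleton_subset_iff.2 hf.edge_mem)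
    (Set.disjoint_singleton.2 hef) (acyc e he) (acyc f hf)
    (fun p q => ⟨join e f he hf p q, join f e hf he p q⟩)
  rcases hG.2 K hKG hK with rfl | ⟨u, rfl⟩
  · have hle : K.degree v ≤ ({e, f} : Set β).ncard :=
      Set.ncard_le_ncard ((K.incidenceSet_subset_edgeSet v).trans hKE) (Set.toFinite _)
    have := Set.ncard_pair hef
    omega
  · have hvK : v ∈ V(Graph.noEdge {u} β) := hKV ▸ (Joined.refl : G.Joined {e} v v)
    have hwK : w ∈ V(Graph.noEdge {u} β) := hKV ▸ (Joined.single rfl he : G.Joined {e} v w)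
    exact hvw (hvK.trans hwK.symm)

/-- The three neighbours of a vertex of degree three in an atomic bispanning graph are distinct. -/
lemma IsAtomicBispanning.pairwise_ne (hG : G.IsAtomicBispanning) (hdeg : G.degree v = 3)
    {x y z : α} (hN : {w | G.Adj v w} = {x, y, z}) : x ≠ y ∧ x ≠ z ∧ y ≠ z := by
  obtain ⟨e₁, e₂, e₃, h12, h13, h23, hinc⟩ := Set.ncard_eq_three.1 hdeg
  have hmem : ∀ e ∈ ({e₁, e₂, e₃} : Set β), ∃ p ∈ ({x, y, z} : Set α), G.IsLink e v p := by
    intro e he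
    obtain ⟨p, hp⟩ : G.Inc e v := (hinc ▸ he : e ∈ G.incidenceSet v)
    exact ⟨p, hN ▸ (hp.adj : p ∈ {w | G.Adj v w}), hp⟩
  -- The three edges are pairwise not parallel, so their other ends are three distinct members of
  -- `{x, y, z}`.
  obtain ⟨p₁, hp₁, hl₁⟩ := hmem e₁ (by simp)
  obtain ⟨p₂, hp₂, hl₂⟩ := hmem e₂ (by simp)
  obtain ⟨p₃, hp₃, hl₃⟩ := hmem e₃ (by simp)
  have hd : 2 < G.degree v := by omega
  have h12' : p₁ ≠ p₂ := fun h => h12 (hG.eq_of_isLink hd hl₁ (h ▸ hl₂))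
  have h13' : p₁ ≠ p₃ := fun h => h13 (hG.eq_of_isLink hd hl₁ (h ▸ hl₃))
  have h23' : p₂ ≠ p₃ := fun h => h23 (hG.eq_of_isLink hd hl₂ (h ▸ hl₃))
  simp only [Set.mem_insert_iff, Set.mem_singleton_iff] at hp₁ hp₂ hp₃
  grind

lemma IsAtomicBispanning.isClawAt (hG : G.IsAtomicBispanning) (hdeg : G.degree v = 3)
    {x y z : α} (hN : {w | G.Adj v w} = {x, y, z}) {ex ey ez : β} (hx : G.IsLink ex v x)
    (hy : G.IsLink ey v y) (hz : G.IsLink ez v z) : G.IsClawAt v x y z ex ey ez := by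
  obtain ⟨hxy, hxz, hyz⟩ := hG.pairwise_ne hdeg hN
  refine ⟨fun e w => hG.1.not_isLink_self, fun e w => ⟨fun hl => ?_, ?_⟩, hxy, hxz, hyz⟩
  · have hd : 2 < G.degree v := by omega
    rcases (hN ▸ (hl.adj : w ∈ {w | G.Adj v w}) : w ∈ ({x, y, z} : Set α)) with rfl | rfl | rfl
    · exact Or.inl ⟨hG.eq_of_isLink hd hl hx, rfl⟩
    · exact Or.inr (Or.inl ⟨hG.eq_of_isLink hd hl hy, rfl⟩)
    · exact Or.inr (Or.inr ⟨hG.eq_of_isLink hd hl hz, rfl⟩)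
  · rintro (⟨rfl, rfl⟩ | ⟨rfl, rfl⟩ | ⟨rfl, rfl⟩) <;> assumption

end

end Graph

theorem mainTheorem5 {α β : Type*} (G : Graph α β) (hV : V(G).Finite) (hE : E(G).Finite)
    (hG : G.IsAtomicBispanning) (v : α) (hv : v ∈ V(G)) (hdeg : G.degree v = 3)
    (x y z : α) (hN : {w | G.Adj v w} = {x, y, z}) :
    -- the three neighbours are distinct
    (x ≠ y ∧ x ≠ z ∧ y ≠ z) ∧
    -- `ex`, `ey`, `ez` are the edges joining `v` to `x`, `y`, `z`
    ∀ ex ey ez : β, G.IsLink ex v x → G.IsLink ey v y → G.IsLink ez v z →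
    -- `(a, b)` is one of the three pairs `(x, y)`, `(x, z)`, `(y, z)`; `c` is the third neighbour
    ∀ (a b c : α) (ea eb ec : β),
      ((a, b, c, ea, eb, ec) ∈
        ({(x, y, z, ex, ey, ez), (x, z, y, ex, ez, ey), (y, z, x, ey, ez, ex)} :
          Set (α × α × α × β × β × β))) →
      -- both descriptions of the reduction graph give a bispanning graph
      ((G.contract {v, a} a).deleteEdges {ec}).IsBispanning ∧
      ((G.contract {v, b} b).deleteEdges {ec}).IsBispanning ∧
      -- both are `G - v + {a, b}`: they differ only in the name of the edge that replaces `v`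
      (G.contract {v, a} a).deleteEdges {ec} = (G.deleteVerts {v}).addEdge eb a b ∧
      (G.contract {v, b} b).deleteEdges {ec} = (G.deleteVerts {v}).addEdge ea a b ∧
      -- this edge remains and has the ends `a` and `b`
      ((G.contract {v, a} a).deleteEdges {ec}).IsLink eb a b ∧
      ((G.contract {v, b} b).deleteEdges {ec}).IsLink ea a b ∧
      -- splitting it and attaching the new vertex `v` to `c` gives back `G`
      Graph.IsEdgeSplitAttach ((G.contract {v, a} a).deleteEdges {ec}) G eb a b c v ea eb ec ∧
      Graph.IsEdgeSplitAttach ((G.contract {v, b} b).deleteEdges {ec}) G ea a b c v ea eb ec := by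
  refine ⟨hG.pairwise_ne hdeg hN, fun ex ey ez hx hy hz a b c ea eb ec hmem => ?_⟩
  have hclaw := hG.isClawAt hdeg hN hx hy hz
  have h : G.IsClawAt v a b c ea eb ec := by
    simp only [Set.mem_insert_iff, Set.mem_singleton_iff, Prod.mk.injEq] at hmem
    rcases hmem with ⟨rfl, rfl, rfl, rfl, rfl, rfl⟩ | ⟨rfl, rfl, rfl, rfl, rfl, rfl⟩ |
      ⟨rfl, rfl, rfl, rfl, rfl, rfl⟩
    exacts [hclaw, hclaw.swap_right, hclaw.swap_left.swap_right]
  have h₁ := h.contract_deleteEdges_eq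
  have h₂ : (G.contract {v, b} b).deleteEdges {ec} = (G.deleteVerts {v}).addEdge ea a b := by
    -- Exchanging `a` and `b` in the claw yields the new edge with its ends in reverse order.
    rw [h.swap_left.contract_deleteEdges_eq, Graph.addEdge_comm]
  have hea := h.notMem_deleteVerts
  have heb := h.swap_left.notMem_deleteVerts
  rw [h₁, h₂]
  exact ⟨h.isBispanning_addEdge hE hG heb, h.isBispanning_addEdge hE hG hea, rfl, rfl,
    Or.inr ⟨rfl, Or.inl ⟨rfl, rfl⟩⟩, Or.inr ⟨rfl, Or.inl ⟨rfl, rfl⟩⟩,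
    h.isEdgeSplitAttach heb, h.isEdgeSplitAttach hea⟩
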